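/- Let $\alpha_1,\dots,\alpha_m$ be covectors on $V=\mathbb{C}^N$ with multiplicities $c_1,\dots,c_m\in\mathbb{C}$. For $\lambda\in\mathbb{C}$ consider the function $$F(x,y)=\tfrac13 y^3+\sum_{k} c_k\,\alpha_k(x)^2\,y+\lambda\sum_{k} c_k\, f(\alpha_k(x)),\qquad x=(x_1,\dots,x_N)\in V,\quad y=x_{N+1}\in\mathbb{C},$$ where $f$ is a holomorphic function with $f'''(z)=\cot z$ on an open set $D\subset\mathbb{C}\setminus\pi\mathbb{Z}$, and $F$ is considered on the domain $\Omega_D=\{(x,y):\alpha_k(x)\in D\text{ for all }k\}$, which is assumed non-empty. The basic example of such an $f$ is any holomorphic branch, on a connected open set, of the multivalued function $\tfrac16 i z^3+\tfrac14\mathrm{Li}_3(e^{-2iz})$, where $\mathrm{Li}_3(w)=\sum_{n\ge1}w^n/n^3$; every such branch satisfies $f'''=\cot$. The WDVV equations for $F$ are $$F_iF_{N+1}^{-1}F_j=F_jF_{N+1}^{-1}F_i,\qquad i,j=1,\dots,N,$$ where $F_i$ is the $(N+1)\times(N+1)$ matrix with entries $(F_i)_{pq}=\dfrac{\partial^3F}{\partial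 x_i\,\partial x_p\,\partial x_q}$ (with $F_{N+1}$ required to be invertible). (1) Let the configuration be $F_4^+\subset(\mathbb{C}^4)^*$: the covectors $e^i$ ($1\le i\le4$) and $\frac12(e^1\pm e^2\pm e^3\pm e^4)$ with multiplicity $s$, and $e^i\pm e^j$ ($1\le i<j\le4$) with multiplicity $r$, where $r,s\in\mathbb{C}$, $2r+s\ne0$ and $4r+s\ne0$. Then $F$ satisfies the WDVV equations on $\Omega_D$ if and only if $$\lambda=\pm\,6\sqrt3\,(2r+s)(4r+s)^{-1/2}.$$ (2) Let the configuration be $G_2^+\subset(\mathbb{C}^2)^*$: the covectors $\sqrt3e^1$ and $\frac{\sqrt3}{2}e^1\pm\frac32e^2$ with multiplicity $q$, and $e^2$ and $\frac{\sqrt3}{2}e^1\pm\frac12e^2$ with multiplicity $p$, where $p,q\in\mathbb{C}$, $p+3q\ne0$ and $p+9q\ne0$. Then $F$ satisfies the WDVV equations on $\Omega_D$ if and only if $$\lambda=\pm\,6\,(p+3q)(p+9q)^{-1/2}.$$ (The sign $\pm$ corresponds to the choice of the square root.) -/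

import Mathlib

noncomputable section

namespace TrigWDVV

/-- The trilogarithm series `Li₃(w) = ∑_{n ≥ 1} wⁿ / n³` (convergent for `|w| ≤ 1`). -/
def trilog (w : ℂ) : ℂ := ∑' n : ℕ, w ^ (n + 1) / ((n : ℂ) + 1) ^ 3

/-- `f` is, on the connected open set `D ⊆ ℂ \ πℤ`, a holomorphic branch of the (multivalued)
function `i z³ / 6 + Li₃(e^{-2iz}) / 4`: it is holomorphic on `D` and coincides with the
convergent series on some nonempty open part of `D` in the half-plane `Im z < 0`
(where `|e^{-2iz}| < 1`). -/
structure IsTrilogBranch (f : ℂ → ℂ) (D : Set ℂ) : Prop where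
  isOpen : IsOpen D
  isPreconnected : IsPreconnected D
  sin_ne_zero : ∀ z ∈ D, Complex.sin z ≠ 0
  holomorphic : DifferentiableOn ℂ f D
  eq_series : ∃ U : Set ℂ, IsOpen U ∧ U.Nonempty ∧ U ⊆ D ∧
    ∀ z ∈ U, z.im < 0 ∧
      f z = Complex.I * z ^ 3 / 6 + trilog (Complex.exp (-2 * Complex.I * z)) / 4

/-- `f` is holomorphic on the open set `D ⊆ ℂ \ πℤ` and `f''' = cot` there. -/
structure IsCotPotential (f : ℂ → ℂ) (D : Set ℂ) : Prop where
  isOpen : IsOpen D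
  sin_ne_zero : ∀ z ∈ D, Complex.sin z ≠ 0
  holomorphic : DifferentiableOn ℂ f D
  third_deriv : ∀ z ∈ D, iteratedDeriv 3 f z = Complex.cot z

/-- The value `α(x) = ∑ αᵢ xᵢ` of the covector `α` on the `V`-component of
`X = (x₁, …, x_N, x_{N+1}) ∈ V ⊕ U`. -/
def covalue {N : ℕ} (α : Fin N → ℂ) (X : Fin (N + 1) → ℂ) : ℂ :=
  ∑ i : Fin N, α i * X i.castSucc

/-- The prepotential
`F = y³ / 3 + ∑ c_α α(x)² y + lam ∑ c_α f(α(x))`, with `y = x_{N+1}`, of the configuration of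
covectors `α k` with multiplicities `c k`. -/
def prepotential {N : ℕ} {ι : Type} [Fintype ι] (α : ι → Fin N → ℂ) (c : ι → ℂ) (f : ℂ → ℂ)
    (lam : ℂ) (X : Fin (N + 1) → ℂ) : ℂ :=
  X (Fin.last N) ^ 3 / 3 + (∑ k, c k * covalue (α k) X ^ 2) * X (Fin.last N)
    + lam * ∑ k, c k * f (covalue (α k) X)

/-- The partial derivative `∂F / ∂x_i`. -/
def partialDeriv {M : ℕ} (i : Fin M) (F : (Fin M → ℂ) → ℂ) (X : Fin M → ℂ) : ℂ :=
  lineDeriv ℂ F X (Pi.single i 1)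

/-- The matrix `F_i` with entries `∂³F / ∂x_i ∂x_p ∂x_q` at `X`. -/
def thirdDerivMatrix {M : ℕ} (F : (Fin M → ℂ) → ℂ) (X : Fin M → ℂ) (i : Fin M) :
    Matrix (Fin M) (Fin M) ℂ :=
  Matrix.of fun p q => partialDeriv i (partialDeriv p (partialDeriv q F)) X

/-- `F` solves the WDVV equations `F_i F_{N+1}⁻¹ F_j = F_j F_{N+1}⁻¹ F_i`, `1 ≤ i, j ≤ N`,
on `Ω` (in particular `F_{N+1}` is invertible on `Ω`). -/
def SolvesWDVV {N : ℕ} (F : (Fin (N + 1) → ℂ) → ℂ) (Ω : Set (Fin (N + 1) → ℂ)) : Prop :=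
  ∀ X ∈ Ω, IsUnit (thirdDerivMatrix F X (Fin.last N)).det ∧
    ∀ i j : Fin N,
      thirdDerivMatrix F X i.castSucc * (thirdDerivMatrix F X (Fin.last N))⁻¹ *
          thirdDerivMatrix F X j.castSucc =
        thirdDerivMatrix F X j.castSucc * (thirdDerivMatrix F X (Fin.last N))⁻¹ *
          thirdDerivMatrix F X i.castSucc

/-- The set of points `(x, y)` at which all the terms `f(α(x))` are defined,
for `f` given on `D`. -/
def potentialDomain {N : ℕ} {ι : Type} (α : ι → Fin N → ℂ) (D : Set ℂ) :
    Set (Fin (N + 1) → ℂ) :=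
  {X | ∀ k, covalue (α k) X ∈ D}

/-- A sign `±1`. -/
def sgn (b : Bool) : ℂ := if b then 1 else -1

/-- Labels of the 24 positive roots of `F₄`: the `eⁱ`, the `½(e¹ ± e² ± e³ ± e⁴)`, and the
`eⁱ ± eʲ` with `i < j`. -/
abbrev F4Index : Type :=
  Fin 4 ⊕ (Bool × Bool × Bool) ⊕ ({p : Fin 4 × Fin 4 // p.1 < p.2} × Bool)

/-- The positive roots of `F₄`. -/
def F4root : F4Index → Fin 4 → ℂ
  | .inl i => Pi.single i 1
  | .inr (.inl (a, b, d)) => ![1 / 2, sgn a / 2, sgn b / 2, sgn d / 2]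
  | .inr (.inr (p, b)) => Pi.single p.1.1 1 + sgn b • Pi.single p.1.2 1

/-- Multiplicity `s` on the short roots and `r` on the long roots of `F₄`. -/
def F4mult (r s : ℂ) : F4Index → ℂ
  | .inl _ => s
  | .inr (.inl _) => s
  | .inr (.inr _) => r

/-- The positive roots of `G₂`: three long ones, then three short ones. -/
def G2root : Fin 6 → Fin 2 → ℂ :=
  ![![(√3 : ℝ), 0], ![(√3 : ℝ) / 2, 3 / 2], ![(√3 : ℝ) / 2, -3 / 2],
    ![0, 1], ![(√3 : ℝ) / 2, 1 / 2], ![(√3 : ℝ) / 2, -1 / 2]]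

/-- Multiplicity `q` on the long roots and `p` on the short roots of `G₂`. -/
def G2mult (q p : ℂ) : Fin 6 → ℂ := ![q, q, q, p, p, p]

end TrigWDVV

end

open Topology Filter

namespace TrigWDVV

/-! Both configurations have a scalar Gram form, ∑ c_α α ⊗ α = g·Id, so F_{N+1} is the constant
matrix diag(2g, …, 2g, 2), invertible since g ≠ 0. The remaining F_i consist of lam times the
symmetric cubic tensor T = ∑ c_α cot(α) α⊗α⊗α, bordered by 2g·Id. WDVV then says exactly that lam²
[T_i, T_j] equals -4g³ times the identity on bivectors (`solvesWDVV_iff`).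

Symmetrising over pairs of covectors, the commutator is the sum over unordered pairs {α, β} of c_α
c_β (α, β) cot α cot β (α∧β)⊗(α∧β). Orthogonal pairs drop out. If α + β = γ, the bivectors α∧β, α∧γ
and γ∧β coincide, so the terms can be grouped by such triples, and the addition theorem cot α cot β
- cot γ (cot α + cot β) = 1 removes all dependence on the point (`cot_mul_cot_sub`). What remains is
a constant -K times the identity on bivectors, with K = (3/8)(p+3q)(p+9q) for G₂ (`G2_cotCurvature`)
and K = (2r+s)(4r+s) for F₄ (`F4tensor_commutator`). WDVV thus becomes lam² K = 4g³, with g =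
(3/2)(p+3q) and g = 3(2r+s) respectively; solving for lam gives the two values. -/

theorem covalue_add_smul {N : ℕ} (α : Fin N → ℂ) (X v : Fin (N + 1) → ℂ) (t : ℂ) :
    covalue α (X + t • v) = covalue α X + t * covalue α v := by
  simp only [covalue, Pi.add_apply, Pi.smul_apply, smul_eq_mul, mul_add, Finset.sum_add_distrib,
    Finset.mul_sum]
  congr 1
  exact Finset.sum_congr rfl fun i _ => by ring

@[simp] theorem covalue_single_castSucc {N : ℕ} (α : Fin N → ℂ) (i : Fin N) :
    covalue α (Pi.single i.castSucc 1) = α i := by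
  simp [covalue, Pi.single_apply]

@[simp] theorem covalue_single_last {N : ℕ} (α : Fin N → ℂ) :
    covalue α (Pi.single (Fin.last N) 1) = 0 := by
  simp [covalue]

theorem continuous_covalue {N : ℕ} (α : Fin N → ℂ) : Continuous (covalue α) := by
  unfold covalue; fun_prop

theorem isOpen_potentialDomain {N : ℕ} {ι : Type} [Finite ι] (α : ι → Fin N → ℂ) {D : Set ℂ}
    (hD : IsOpen D) : IsOpen (potentialDomain α D) := by
  have : potentialDomain α D = ⋂ k, covalue (α k) ⁻¹' D := by
    ext X; simp [potentialDomain]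
  rw [this]
  exact isOpen_iInter_of_finite fun k => hD.preimage (continuous_covalue _)

theorem hasDerivAt_covalue_line {N : ℕ} (α : Fin N → ℂ) (X v : Fin (N + 1) → ℂ) :
    HasDerivAt (fun t : ℂ => covalue α (X + t • v)) (covalue α v) 0 := by
  simp only [covalue_add_smul]
  simpa using ((hasDerivAt_id (0 : ℂ)).mul_const (covalue α v)).const_add (covalue α X)

theorem hasDerivAt_coord_line {M : ℕ} (j : Fin M) (X v : Fin M → ℂ) :
    HasDerivAt (fun t : ℂ => (X + t • v) j) (v j) 0 := by
  simpa using ((hasDerivAt_id (0 : ℂ)).mul_const (v j)).const_add (X j)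

theorem hasDerivAt_comp_covalue_line {N : ℕ} (α : Fin N → ℂ) (X v : Fin (N + 1) → ℂ)
    {g : ℂ → ℂ} {g' : ℂ} (hg : HasDerivAt g g' (covalue α X)) :
    HasDerivAt (fun t : ℂ => g (covalue α (X + t • v))) (g' * covalue α v) 0 := by
  have h := hasDerivAt_covalue_line α X v
  have hg' : HasDerivAt g g' (covalue α (X + (0 : ℂ) • v)) := by simpa using hg
  exact hg'.comp (0 : ℂ) h

/-! ### Third derivatives of the prepotential. -/

section ThirdDerivative

variable {N : ℕ} {ι : Type} [Fintype ι] (α : ι → Fin N → ℂ) (c : ι → ℂ) {f : ℂ → ℂ} (lam : ℂ)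
  {D : Set ℂ}

theorem lineDeriv_prepotential (hD : IsOpen D) (hf : DifferentiableOn ℂ f D)
    {X : Fin (N + 1) → ℂ} (hX : X ∈ potentialDomain α D) (u : Fin (N + 1) → ℂ) :
    lineDeriv ℂ (prepotential α c f lam) X u =
      X (Fin.last N) ^ 2 * u (Fin.last N)
        + ((∑ k, c k * (2 * covalue (α k) X * covalue (α k) u)) * X (Fin.last N)
        + (∑ k, c k * covalue (α k) X ^ 2) * u (Fin.last N))
        + lam * ∑ k, c k * (deriv f (covalue (α k) X) * covalue (α k) u) := by
  have hy := hasDerivAt_coord_line (Fin.last N) X u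
  have h2 : HasDerivAt (fun t : ℂ => ∑ k, c k * covalue (α k) (X + t • u) ^ 2)
      (∑ k, c k * (2 * covalue (α k) X * covalue (α k) u)) 0 :=
    HasDerivAt.fun_sum fun k _ => by
      simpa using ((hasDerivAt_covalue_line (α k) X u).pow 2).const_mul (c k)
  have h3 : HasDerivAt (fun t : ℂ => ∑ k, c k * f (covalue (α k) (X + t • u)))
      (∑ k, c k * (deriv f (covalue (α k) X) * covalue (α k) u)) 0 :=
    HasDerivAt.fun_sum fun k _ => (hasDerivAt_comp_covalue_line (α k) X u
      ((hf.differentiableAt (hD.mem_nhds (hX k))).hasDerivAt)).const_mul (c k)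
  have h := (((hy.pow 3).div_const 3).add (h2.mul hy)).add (h3.const_mul lam)
  have h' : HasLineDerivAt ℂ (prepotential α c f lam) _ X u := h
  rw [h'.lineDeriv]
  simp
  ring

theorem lineDeriv_lineDeriv_prepotential (hD : IsOpen D) (hf : DifferentiableOn ℂ f D)
    {X : Fin (N + 1) → ℂ} (hX : X ∈ potentialDomain α D) (u v : Fin (N + 1) → ℂ) :
    lineDeriv ℂ (fun Y => lineDeriv ℂ (prepotential α c f lam) Y u) X v =
      2 * X (Fin.last N) * v (Fin.last N) * u (Fin.last N)
        + ((∑ k, c k * (2 * covalue (α k) v * covalue (α k) u)) * X (Fin.last N)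
        + (∑ k, c k * (2 * covalue (α k) X * covalue (α k) u)) * v (Fin.last N)
        + (∑ k, c k * (2 * covalue (α k) X * covalue (α k) v)) * u (Fin.last N))
        + lam * ∑ k, c k * (deriv (deriv f) (covalue (α k) X) * covalue (α k) v
          * covalue (α k) u) := by
  -- The first-order formula holds only on the domain; that set is open, so the germ at `X` is
  -- known, which is all a line derivative sees.
  have he : (fun Y => lineDeriv ℂ (prepotential α c f lam) Y u) =ᶠ[𝓝 X] _ :=
    eventually_of_mem ((isOpen_potentialDomain α hD).mem_nhds hX)
      fun Y hY => lineDeriv_prepotential α c lam hD hf hY u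
  rw [he.lineDeriv_eq]
  have hy := hasDerivAt_coord_line (Fin.last N) X v
  have h1 : HasDerivAt (fun t : ℂ => ∑ k, c k * (2 * covalue (α k) (X + t • v) * covalue (α k) u))
      (∑ k, c k * (2 * covalue (α k) v * covalue (α k) u)) 0 :=
    HasDerivAt.fun_sum fun k _ =>
      (((hasDerivAt_covalue_line (α k) X v).const_mul 2).mul_const _).const_mul (c k)
  have h2 : HasDerivAt (fun t : ℂ => ∑ k, c k * covalue (α k) (X + t • v) ^ 2)
      (∑ k, c k * (2 * covalue (α k) X * covalue (α k) v)) 0 :=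
    HasDerivAt.fun_sum fun k _ => by
      simpa using ((hasDerivAt_covalue_line (α k) X v).pow 2).const_mul (c k)
  have h3 : HasDerivAt
      (fun t : ℂ => ∑ k, c k * (deriv f (covalue (α k) (X + t • v)) * covalue (α k) u))
      (∑ k, c k * (deriv (deriv f) (covalue (α k) X) * covalue (α k) v * covalue (α k) u)) 0 :=
    HasDerivAt.fun_sum fun k _ => ((hasDerivAt_comp_covalue_line (α k) X v
      (((hf.deriv hD).differentiableAt (hD.mem_nhds (hX k))).hasDerivAt)).mul_const _).const_mul
        (c k)
  have h := (((hy.pow 2).mul_const (u (Fin.last N))).add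
    ((h1.mul hy).add (h2.mul_const (u (Fin.last N))))).add (h3.const_mul lam)
  have h' : HasLineDerivAt ℂ (fun Y => Y (Fin.last N) ^ 2 * u (Fin.last N)
        + ((∑ k, c k * (2 * covalue (α k) Y * covalue (α k) u)) * Y (Fin.last N)
        + (∑ k, c k * covalue (α k) Y ^ 2) * u (Fin.last N))
        + lam * ∑ k, c k * (deriv f (covalue (α k) Y) * covalue (α k) u)) _ X v := h
  rw [h'.lineDeriv]
  simp

theorem lineDeriv_lineDeriv_lineDeriv_prepotential (hf : IsCotPotential f D)
    {X : Fin (N + 1) → ℂ} (hX : X ∈ potentialDomain α D) (u v w : Fin (N + 1) → ℂ) :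
    lineDeriv ℂ (fun Z => lineDeriv ℂ (fun Y => lineDeriv ℂ (prepotential α c f lam) Y u) Z v) X w =
      2 * w (Fin.last N) * v (Fin.last N) * u (Fin.last N)
        + ((∑ k, c k * (2 * covalue (α k) v * covalue (α k) u)) * w (Fin.last N)
        + (∑ k, c k * (2 * covalue (α k) w * covalue (α k) u)) * v (Fin.last N)
        + (∑ k, c k * (2 * covalue (α k) w * covalue (α k) v)) * u (Fin.last N))
        + lam * ∑ k, c k * (Complex.cot (covalue (α k) X) * covalue (α k) w * covalue (α k) v
          * covalue (α k) u) := by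
  have hD := hf.isOpen
  have he : (fun Z => lineDeriv ℂ (fun Y => lineDeriv ℂ (prepotential α c f lam) Y u) Z v)
      =ᶠ[𝓝 X] _ :=
    eventually_of_mem ((isOpen_potentialDomain α hD).mem_nhds hX)
      fun Y hY => lineDeriv_lineDeriv_prepotential α c lam hD hf.holomorphic hY u v
  rw [he.lineDeriv_eq]
  have hy := hasDerivAt_coord_line (Fin.last N) X w
  have h1 (u : Fin (N + 1) → ℂ) :
      HasDerivAt (fun t : ℂ => ∑ k, c k * (2 * covalue (α k) (X + t • w) * covalue (α k) u))
      (∑ k, c k * (2 * covalue (α k) w * covalue (α k) u)) 0 :=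
    HasDerivAt.fun_sum fun k _ =>
      (((hasDerivAt_covalue_line (α k) X w).const_mul 2).mul_const _).const_mul (c k)
  have h3 : HasDerivAt
      (fun t : ℂ => ∑ k, c k * (deriv (deriv f) (covalue (α k) (X + t • w)) * covalue (α k) v
        * covalue (α k) u))
      (∑ k, c k * (Complex.cot (covalue (α k) X) * covalue (α k) w * covalue (α k) v
        * covalue (α k) u)) 0 :=
    HasDerivAt.fun_sum fun k _ => by
      refine (((hasDerivAt_comp_covalue_line (α k) X w ?_).mul_const _).mul_const _).const_mul (c k)
      rw [← hf.third_deriv _ (hX k), iteratedDeriv_succ, iteratedDeriv_succ, iteratedDeriv_one]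
      exact (((hf.holomorphic.deriv hD).deriv hD).differentiableAt (hD.mem_nhds (hX k))).hasDerivAt
  have h := ((((hy.const_mul 2).mul_const (v (Fin.last N))).mul_const (u (Fin.last N))).add
    (((hy.const_mul (∑ k, c k * (2 * covalue (α k) v * covalue (α k) u))).add
      ((h1 u).mul_const (v (Fin.last N)))).add ((h1 v).mul_const (u (Fin.last N))))).add
        (h3.const_mul lam)
  have h' : HasLineDerivAt ℂ (fun X => 2 * X (Fin.last N) * v (Fin.last N) * u (Fin.last N)
        + ((∑ k, c k * (2 * covalue (α k) v * covalue (α k) u)) * X (Fin.last N)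
        + (∑ k, c k * (2 * covalue (α k) X * covalue (α k) u)) * v (Fin.last N)
        + (∑ k, c k * (2 * covalue (α k) X * covalue (α k) v)) * u (Fin.last N))
        + lam * ∑ k, c k * (deriv (deriv f) (covalue (α k) X) * covalue (α k) v
          * covalue (α k) u)) _ X w := h
  exact h'.lineDeriv

/-- The contracted cubic form `∑ c_α α_i α_p α_q cot α(X)`. -/
noncomputable def cotTensor (X : Fin (N + 1) → ℂ) (i p q : Fin N) : ℂ :=
  ∑ k, c k * (α k i * α k p * α k q * Complex.cot (covalue (α k) X))

theorem thirdDerivMatrix_prepotential (hf : IsCotPotential f D)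
    {X : Fin (N + 1) → ℂ} (hX : X ∈ potentialDomain α D) (i p q : Fin (N + 1)) :
    thirdDerivMatrix (prepotential α c f lam) X i p q =
      2 * (Pi.single i 1 : Fin (N + 1) → ℂ) (Fin.last N)
          * (Pi.single p 1 : Fin (N + 1) → ℂ) (Fin.last N)
          * (Pi.single q 1 : Fin (N + 1) → ℂ) (Fin.last N)
        + ((∑ k, c k * (2 * covalue (α k) (Pi.single p 1) * covalue (α k) (Pi.single q 1)))
            * (Pi.single i 1 : Fin (N + 1) → ℂ) (Fin.last N)
        + (∑ k, c k * (2 * covalue (α k) (Pi.single i 1) * covalue (α k) (Pi.single q 1)))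
            * (Pi.single p 1 : Fin (N + 1) → ℂ) (Fin.last N)
        + (∑ k, c k * (2 * covalue (α k) (Pi.single i 1) * covalue (α k) (Pi.single p 1)))
            * (Pi.single q 1 : Fin (N + 1) → ℂ) (Fin.last N))
        + lam * ∑ k, c k * (Complex.cot (covalue (α k) X) * covalue (α k) (Pi.single i 1)
          * covalue (α k) (Pi.single p 1) * covalue (α k) (Pi.single q 1)) :=
  lineDeriv_lineDeriv_lineDeriv_prepotential α c lam hf hX _ _ _

variable {α c} {g : ℂ}

/-- The covectors vanish on the last basis vector, so the cotangent terms disappear and only the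
Gram form and y³/3 contribute. -/
theorem thirdDerivMatrix_last (hG : ∀ i j, ∑ k, c k * (α k i * α k j) = if i = j then g else 0)
    (hf : IsCotPotential f D) {X : Fin (N + 1) → ℂ} (hX : X ∈ potentialDomain α D) :
    thirdDerivMatrix (prepotential α c f lam) X (Fin.last N) =
      Matrix.diagonal (Fin.snoc (α := fun _ => ℂ) (fun _ => 2 * g) 2) := by
  ext p q
  rw [thirdDerivMatrix_prepotential α c lam hf hX]
  have hG' (i j) : ∑ k, c k * (2 * α k i * α k j) = 2 * if i = j then g else 0 := by
    rw [← hG, Finset.mul_sum]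
    exact Finset.sum_congr rfl fun k _ => by ring
  induction p using Fin.lastCases with
  | last =>
    induction q using Fin.lastCases with
    | last => simp
    | cast q => simp [(Fin.castSucc_ne_last q).symm]
  | cast p =>
    induction q using Fin.lastCases with
    | last => simp [Fin.castSucc_ne_last p]
    | cast q => simp [Matrix.diagonal_apply, hG', Fin.castSucc_ne_last]

theorem thirdDerivMatrix_castSucc
    (hG : ∀ i j, ∑ k, c k * (α k i * α k j) = if i = j then g else 0)
    (hf : IsCotPotential f D) {X : Fin (N + 1) → ℂ} (hX : X ∈ potentialDomain α D) (i : Fin N) :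
    (∀ p q : Fin N, thirdDerivMatrix (prepotential α c f lam) X i.castSucc p.castSucc q.castSucc
      = lam * cotTensor α c X i p q) ∧
    (∀ p : Fin N, thirdDerivMatrix (prepotential α c f lam) X i.castSucc p.castSucc (Fin.last N)
      = 2 * if i = p then g else 0) ∧
    (∀ q : Fin N, thirdDerivMatrix (prepotential α c f lam) X i.castSucc (Fin.last N) q.castSucc
      = 2 * if i = q then g else 0) ∧
    thirdDerivMatrix (prepotential α c f lam) X i.castSucc (Fin.last N) (Fin.last N) = 0 := by
  have hG' (i j) : ∑ k, c k * (2 * α k i * α k j) = 2 * if i = j then g else 0 := by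
    rw [← hG, Finset.mul_sum]
    exact Finset.sum_congr rfl fun k _ => by ring
  refine ⟨fun p q => ?_, fun p => ?_, fun q => ?_, ?_⟩ <;>
    rw [thirdDerivMatrix_prepotential α c lam hf hX]
  · simp only [covalue_single_castSucc, Pi.single_eq_of_ne (Fin.castSucc_ne_last _).symm, cotTensor]
    simp only [mul_zero, add_zero, zero_add]
    congr 1
    exact Finset.sum_congr rfl fun k _ => by ring
  · simp [hG']
  · simp [hG']
  · simp

/-! ### WDVV as an equation for the commutator of the cotangent tensor. -/

theorem cotTensor_swap (X : Fin (N + 1) → ℂ) (i p q : Fin N) :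
    cotTensor α c X i p q = cotTensor α c X p i q :=
  Finset.sum_congr rfl fun k _ => by ring

theorem cotTensor_swap_right (X : Fin (N + 1) → ℂ) (i p q : Fin N) :
    cotTensor α c X i p q = cotTensor α c X i q p :=
  Finset.sum_congr rfl fun k _ => by ring

/-- The commutator of the cotangent-weighted forms. -/
noncomputable def cotCurvature (α : ι → Fin N → ℂ) (c : ι → ℂ) (X : Fin (N + 1) → ℂ)
    (i j p q : Fin N) : ℂ :=
  ∑ m, (cotTensor α c X i p m * cotTensor α c X j m q
    - cotTensor α c X j p m * cotTensor α c X i m q)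

/-- Only the entries with p, q ≤ N carry information: those in the last row or column agree
automatically because the cubic tensor is totally symmetric. The factor 4g³ is the border term 2g²
multiplied by the 2g that clears the inverse of F_{N+1}. -/
theorem solvesWDVV_iff (hg : g ≠ 0)
    (hG : ∀ i j, ∑ k, c k * (α k i * α k j) = if i = j then g else 0)
    (hf : IsCotPotential f D) :
    SolvesWDVV (prepotential α c f lam) (potentialDomain α D) ↔
      ∀ X ∈ potentialDomain α D, ∀ i j p q : Fin N,
        lam ^ 2 * cotCurvature α c X i j p q =
          -(4 * g ^ 3 * ((if i = p then 1 else 0) * (if j = q then 1 else 0)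
            - (if j = p then 1 else 0) * (if i = q then 1 else 0))) := by
  refine forall₂_congr fun X hX => ?_
  have hlast := thirdDerivMatrix_last lam hG hf hX
  have hblocks := thirdDerivMatrix_castSucc lam hG hf hX
  generalize thirdDerivMatrix (prepotential α c f lam) X = M at hlast hblocks ⊢
  have hinv : (M (Fin.last N))⁻¹ =
      Matrix.diagonal (Fin.snoc (α := fun _ => ℂ) (fun _ => (2 * g)⁻¹) 2⁻¹) := by
    apply Matrix.inv_eq_right_inv
    rw [hlast, Matrix.diagonal_mul_diagonal, ← Matrix.diagonal_one]
    congr 1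
    ext p
    induction p using Fin.lastCases with
    | last => simp
    | cast p => simp; field_simp
  have hdet : IsUnit (M (Fin.last N)).det := by
    rw [hlast, Matrix.det_diagonal, isUnit_iff_ne_zero, Finset.prod_ne_zero_iff]
    intro p _
    induction p using Fin.lastCases with
    | last => simp
    | cast p => simp [hg]
  have hprod (i j : Fin N) (p q : Fin (N + 1)) :
      (M i.castSucc * (M (Fin.last N))⁻¹ * M j.castSucc) p q =
        ∑ m : Fin N, M i.castSucc p m.castSucc * (2 * g)⁻¹ * M j.castSucc m.castSucc q
          + M i.castSucc p (Fin.last N) * 2⁻¹ * M j.castSucc (Fin.last N) q := by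
    rw [hinv, Matrix.mul_apply, Fin.sum_univ_castSucc]
    simp [Matrix.mul_diagonal]
  have hcc (i j p q : Fin N) :
      (M i.castSucc * (M (Fin.last N))⁻¹ * M j.castSucc) p.castSucc q.castSucc =
        lam ^ 2 * (2 * g)⁻¹ * (∑ m, cotTensor α c X i p m * cotTensor α c X j m q)
          + 2 * g ^ 2 * ((if i = p then 1 else 0) * (if j = q then 1 else 0)) := by
    obtain ⟨a1, a2, a3, a4⟩ := hblocks i
    obtain ⟨b1, b2, b3, b4⟩ := hblocks j
    rw [hprod, a2, b3, Finset.mul_sum]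
    congr 1
    · exact Finset.sum_congr rfl fun m _ => by rw [a1, b1]; ring
    · split_ifs <;> ring
  rw [and_iff_right hdet]
  refine forall₂_congr fun i j => ?_
  obtain ⟨a1, a2, a3, a4⟩ := hblocks i
  obtain ⟨b1, b2, b3, b4⟩ := hblocks j
  have key (p q : Fin N) :
      (M i.castSucc * (M (Fin.last N))⁻¹ * M j.castSucc) p.castSucc q.castSucc =
        (M j.castSucc * (M (Fin.last N))⁻¹ * M i.castSucc) p.castSucc q.castSucc ↔
      lam ^ 2 * cotCurvature α c X i j p q =
          -(4 * g ^ 3 * ((if i = p then 1 else 0) * (if j = q then 1 else 0)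
            - (if j = p then 1 else 0) * (if i = q then 1 else 0))) := by
    rw [hcc, hcc, cotCurvature, Finset.sum_sub_distrib]
    generalize (∑ m, cotTensor α c X i p m * cotTensor α c X j m q) = A
    generalize (∑ m, cotTensor α c X j p m * cotTensor α c X i m q) = B
    generalize ((if i = p then 1 else 0) * (if j = q then 1 else 0) : ℂ) = d
    generalize ((if j = p then 1 else 0) * (if i = q then 1 else 0) : ℂ) = e
    field_simp
    constructor <;> intro h <;> linear_combination h
  constructor
  · intro h p q
    rw [← key, h]
  · intro h
    ext p q
    induction p using Fin.lastCases with
    | last =>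
      induction q using Fin.lastCases with
      | last =>
        rw [hprod, hprod, a4, b4]
        congr 1
        exact Finset.sum_congr rfl fun m _ => by rw [a2, a3, b2, b3]; ring
      | cast q =>
        rw [hprod, hprod, a4, b4]
        simp only [a1, a3, b1, b3]
        simp [cotTensor_swap (α := α) X i j q]
    | cast p =>
      induction q using Fin.lastCases with
      | last =>
        rw [hprod, hprod, a4, b4]
        simp only [a1, a2, b1, b2]
        simp [cotTensor_swap_right (α := α) X i p j, cotTensor_swap_right (α := α) X j p i,
          cotTensor_swap (α := α) X i j p]
      | cast q => exact (key p q).2 (h p q)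

/-- If the cotangent curvature is a constant multiple of the identity on bivectors, the WDVV
equations reduce to one condition on `lam`. -/
theorem solvesWDVV_iff_of_cotCurvature (hN : 2 ≤ N) (hg : g ≠ 0)
    (hG : ∀ i j, ∑ k, c k * (α k i * α k j) = if i = j then g else 0)
    (hf : IsCotPotential f D) (hne : (potentialDomain α D).Nonempty) {K : ℂ}
    (hK : ∀ X ∈ potentialDomain α D, ∀ i j p q : Fin N, cotCurvature α c X i j p q =
      -(K * ((if i = p then 1 else 0) * (if j = q then 1 else 0)
            - (if j = p then 1 else 0) * (if i = q then 1 else 0)))) :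
    SolvesWDVV (prepotential α c f lam) (potentialDomain α D) ↔ lam ^ 2 * K = 4 * g ^ 3 := by
  rw [solvesWDVV_iff lam hg hG hf]
  constructor
  · intro h
    obtain ⟨X, hX⟩ := hne
    -- One nonzero bivector e₁∧e₂ at one point already forces the condition; this is where N ≥ 2 and
    -- the non-empty domain enter.
    have h01 : (⟨0, by omega⟩ : Fin N) ≠ ⟨1, by omega⟩ := by simp
    have h := h X hX ⟨0, by omega⟩ ⟨1, by omega⟩ ⟨0, by omega⟩ ⟨1, by omega⟩
    rw [hK X hX] at h
    simp only [if_true, if_neg h01, if_neg h01.symm] at h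
    linear_combination -h
  · intro h X hX i j p q
    rw [hK X hX, ← h]
    ring

end ThirdDerivative

/-! ### Trilogarithm branches have third derivative cot. -/

/-- The series `∑ e^{-2i(n+1)z} / (n+1)^k`, i.e. the polylogarithm of order `k` at `e^{-2iz}`. -/
noncomputable def expPolylog (k : ℕ) (z : ℂ) : ℂ :=
  ∑' n : ℕ, Complex.exp (-2 * Complex.I * z) ^ (n + 1) / ((n : ℂ) + 1) ^ k

theorem norm_exp_neg_two_I_mul (z : ℂ) :
    ‖Complex.exp (-2 * Complex.I * z)‖ = Real.exp (2 * z.im) := by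
  rw [Complex.norm_exp]; simp

theorem norm_natCast_add_one_pow_ge (n k : ℕ) : 1 ≤ ‖((n : ℂ) + 1) ^ k‖ := by
  rw [norm_pow]
  apply one_le_pow₀
  have : ((n : ℂ) + 1) = ((n + 1 : ℕ) : ℂ) := by push_cast; rfl
  rw [this, Complex.norm_natCast]
  exact_mod_cast Nat.succ_le_succ (Nat.zero_le n)

theorem norm_expPolylog_term_le {b : ℝ} {z : ℂ} (hz : z.im < b) (k n : ℕ) :
    ‖Complex.exp (-2 * Complex.I * z) ^ (n + 1) / ((n : ℂ) + 1) ^ k‖ ≤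
      Real.exp (2 * b) ^ (n + 1) := by
  rw [norm_div, norm_pow, norm_exp_neg_two_I_mul]
  refine (div_le_self (by positivity) (norm_natCast_add_one_pow_ge n k)).trans ?_
  gcongr

/-- Termwise differentiation: on a half-plane Im w < b with Im z < b < 0, the differentiated series
is dominated by a geometric series of ratio e^{2b} < 1. -/
theorem hasDerivAt_expPolylog (k : ℕ) {z : ℂ} (hz : z.im < 0) :
    HasDerivAt (expPolylog (k + 1)) (-2 * Complex.I * expPolylog k z) z := by
  obtain ⟨b, hzb, hb⟩ := exists_between hz
  have hr : Real.exp (2 * b) < 1 := by rw [Real.exp_lt_one_iff]; linarith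
  have hsum : Summable fun n : ℕ => Real.exp (2 * b) ^ (n + 1) :=
    (summable_nat_add_iff 1).2 (summable_geometric_of_lt_one (Real.exp_pos _).le hr)
  have hopen : IsOpen {w : ℂ | w.im < b} := isOpen_lt Complex.continuous_im continuous_const
  have hconn : IsPreconnected {w : ℂ | w.im < b} := (convex_halfSpace_im_lt b).isPreconnected
  unfold expPolylog
  rw [← tsum_mul_left]
  refine hasDerivAt_tsum_of_isPreconnected (u := fun n : ℕ => 2 * Real.exp (2 * b) ^ (n + 1))
    (hsum.mul_left 2) hopen hconn
    (g := fun (n : ℕ) (w : ℂ) => Complex.exp (-2 * Complex.I * w) ^ (n + 1) / ((n : ℂ) + 1) ^ (k + 1))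
    (g' := fun (n : ℕ) (w : ℂ) =>
      -2 * Complex.I * (Complex.exp (-2 * Complex.I * w) ^ (n + 1) / ((n : ℂ) + 1) ^ k))
    (fun n w _ => ?_) (fun n w hw => ?_) hzb ?_ hzb
  · have hn : (n : ℂ) + 1 ≠ 0 := Nat.cast_add_one_ne_zero n
    have h := ((((hasDerivAt_id w).const_mul (-2 * Complex.I)).cexp.pow (n + 1)).div_const
      (((n : ℂ) + 1) ^ (k + 1)))
    refine h.congr_deriv ?_
    simp only [id, Nat.add_sub_cancel, Nat.cast_add, Nat.cast_one]
    field_simp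
    ring
  · rw [norm_mul]
    have : ‖-2 * Complex.I‖ = 2 := by simp
    rw [this]
    gcongr
    exact norm_expPolylog_term_le hw k n
  · exact Summable.of_norm_bounded hsum fun n => norm_expPolylog_term_le hzb (k + 1) n

theorem expPolylog_zero {z : ℂ} (hz : z.im < 0) :
    expPolylog 0 z = Complex.exp (-2 * Complex.I * z) / (1 - Complex.exp (-2 * Complex.I * z)) := by
  have h : ‖Complex.exp (-2 * Complex.I * z)‖ < 1 := by
    rw [norm_exp_neg_two_I_mul, Real.exp_lt_one_iff]; linarith
  simp only [expPolylog, pow_zero, div_one, pow_succ']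
  rw [tsum_mul_left, tsum_geometric_of_norm_lt_one h, div_eq_mul_inv]

theorem cot_eq_expPolylog_zero {z : ℂ} (hz : z.im < 0) :
    Complex.cot z = Complex.I + 2 * Complex.I * expPolylog 0 z := by
  have h : Complex.exp (-2 * Complex.I * z) ≠ 1 := by
    intro h
    have := norm_exp_neg_two_I_mul z
    rw [h, norm_one] at this
    have := (Real.exp_eq_one_iff _).1 this.symm
    linarith
  rw [expPolylog_zero hz, Complex.cot_eq_exp_ratio]
  have e : Complex.exp (2 * Complex.I * z) * Complex.exp (-2 * Complex.I * z) = 1 := by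
    rw [← Complex.exp_add]; simp
  set w := Complex.exp (-2 * Complex.I * z)
  set v := Complex.exp (2 * Complex.I * z)
  have h1 : 1 - w ≠ 0 := sub_ne_zero.2 (Ne.symm h)
  have h2 : 1 - v ≠ 0 := by
    intro h2
    apply h
    have : v = 1 := (sub_eq_zero.1 h2).symm
    rwa [this, one_mul] at e
  have hI := Complex.I_sq
  have h3 : Complex.I * (1 - v) ≠ 0 := mul_ne_zero Complex.I_ne_zero h2
  rw [div_eq_iff h3]
  field_simp
  rw [hI]
  linear_combination -2 * e

/-- Three derivatives lower the polylogarithm to order 0, a geometric series that gives cot on `U`;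
the identity theorem on the preconnected set `D` extends the equality. -/
theorem IsTrilogBranch.isCotPotential {f : ℂ → ℂ} {D : Set ℂ} (hf : IsTrilogBranch f D) :
    IsCotPotential f D := by
  refine ⟨hf.isOpen, hf.sin_ne_zero, hf.holomorphic, ?_⟩
  obtain ⟨U, hU, ⟨z₀, hz₀⟩, hUD, hUf⟩ := hf.eq_series
  have hf3 : DifferentiableOn ℂ (iteratedDeriv 3 f) D := by
    rw [iteratedDeriv_succ, iteratedDeriv_succ, iteratedDeriv_one]
    exact ((hf.holomorphic.deriv hf.isOpen).deriv hf.isOpen).deriv hf.isOpen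
  have hcot : DifferentiableOn ℂ Complex.cot D := fun z hz => by
    have : Complex.cot = fun z => Complex.cos z / Complex.sin z := rfl
    rw [this]
    exact (Complex.differentiable_cos.differentiableAt.div Complex.differentiable_sin.differentiableAt
      (hf.sin_ne_zero z hz)).differentiableWithinAt
  have h0 : Set.EqOn f (fun z => Complex.I * z ^ 3 / 6 + expPolylog 3 z / 4) U :=
    fun z hz => (hUf z hz).2
  have h1 : Set.EqOn (deriv f)
      (fun z => Complex.I * z ^ 2 / 2 + -2 * Complex.I * expPolylog 2 z / 4) U := fun z hz => by
    rw [(h0.eventuallyEq_of_mem (hU.mem_nhds hz)).deriv_eq]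
    refine (HasDerivAt.congr_deriv (((((hasDerivAt_id z).pow 3).const_mul Complex.I).div_const 6).add
      ((hasDerivAt_expPolylog 2 (hUf z hz).1).div_const 4)) ?_).deriv
    simp; ring
  have h2 : Set.EqOn (deriv (deriv f))
      (fun z => Complex.I * z + -expPolylog 1 z) U := fun z hz => by
    rw [(h1.eventuallyEq_of_mem (hU.mem_nhds hz)).deriv_eq]
    refine (HasDerivAt.congr_deriv (((((hasDerivAt_id z).pow 2).const_mul Complex.I).div_const 2).add
      (((hasDerivAt_expPolylog 1 (hUf z hz).1).const_mul (-2 * Complex.I)).div_const 4)) ?_).deriv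
    simp
    linear_combination expPolylog 1 z * Complex.I_sq
  have h3 : Set.EqOn (iteratedDeriv 3 f) Complex.cot U := fun z hz => by
    rw [iteratedDeriv_succ, iteratedDeriv_succ, iteratedDeriv_one,
      (h2.eventuallyEq_of_mem (hU.mem_nhds hz)).deriv_eq, cot_eq_expPolylog_zero (hUf z hz).1]
    refine (HasDerivAt.congr_deriv (((hasDerivAt_id z).const_mul Complex.I).add
      (hasDerivAt_expPolylog 0 (hUf z hz).1).neg) ?_).deriv
    simp
  exact (hf3.analyticOnNhd hf.isOpen).eqOn_of_preconnected_of_eventuallyEq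
    (hcot.analyticOnNhd hf.isOpen) hf.isPreconnected (hUD hz₀)
    (h3.eventuallyEq_of_mem (hU.mem_nhds hz₀))

/-! ### Cotangent addition theorem and symmetries of the commutator. -/

theorem cot_mul_cot_sub {a b : ℂ} (ha : Complex.sin a ≠ 0) (hb : Complex.sin b ≠ 0)
    (hab : Complex.sin (a + b) ≠ 0) :
    Complex.cot a * Complex.cot b - Complex.cot (a + b) * (Complex.cot a + Complex.cot b) = 1 := by
  simp only [Complex.cot]
  have h1 := Complex.sin_add a b
  have h2 := Complex.cos_add a b
  rw [h2]
  rw [h1] at hab ⊢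
  field_simp
  ring

theorem cot_covalue_relation {N : ℕ} {ι : Type} {α : ι → Fin N → ℂ} {D : Set ℂ} {f : ℂ → ℂ}
    (hf : IsCotPotential f D) {X : Fin (N + 1) → ℂ}
    (hX : X ∈ potentialDomain α D) {k l m : ι} (h : α k + α l = α m) :
    Complex.cot (covalue (α k) X) * Complex.cot (covalue (α l) X)
      - Complex.cot (covalue (α m) X)
        * (Complex.cot (covalue (α k) X) + Complex.cot (covalue (α l) X)) = 1 := by
  have hm : covalue (α m) X = covalue (α k) X + covalue (α l) X := by
    simp [← h, covalue, add_mul, Finset.sum_add_distrib]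
  rw [hm]
  exact cot_mul_cot_sub (hf.sin_ne_zero _ (hX k)) (hf.sin_ne_zero _ (hX l))
    (hm ▸ hf.sin_ne_zero _ (hX m))

section

variable {N : ℕ} {ι : Type} [Fintype ι] {α : ι → Fin N → ℂ} {c : ι → ℂ}

theorem cotCurvature_swap_left (X : Fin (N + 1) → ℂ) (i j p q : Fin N) :
    cotCurvature α c X i j p q = -cotCurvature α c X j i p q := by
  simp [cotCurvature]

theorem cotCurvature_swap_pairs (X : Fin (N + 1) → ℂ) (i j p q : Fin N) :
    cotCurvature α c X i j p q = cotCurvature α c X p q i j := by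
  refine Finset.sum_congr rfl fun m _ => ?_
  rw [cotTensor_swap X i p m, cotTensor_swap_right X j m q, cotTensor_swap X j q m,
    cotTensor_swap_right X q j m, cotTensor_swap X j p m, cotTensor_swap_right X p j m,
    cotTensor_swap_right X i m q, cotTensor_swap X i q m]
  ring

theorem cotCurvature_swap_right (X : Fin (N + 1) → ℂ) (i j p q : Fin N) :
    cotCurvature α c X i j p q = -cotCurvature α c X i j q p := by
  rw [cotCurvature_swap_pairs, cotCurvature_swap_left, cotCurvature_swap_pairs]

/-- Both sides are antisymmetric in (i, j) and in (p, q), as for a Riemann tensor, so ordered index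
pairs suffice. -/
theorem cotCurvature_eq_of_lt {X : Fin (N + 1) → ℂ} {K : ℂ}
    (h : ∀ i j p q : Fin N, i < j → p < q → cotCurvature α c X i j p q =
      -(K * ((if i = p then 1 else 0) * (if j = q then 1 else 0)
            - (if j = p then 1 else 0) * (if i = q then 1 else 0)))) (i j p q : Fin N) :
    cotCurvature α c X i j p q =
      -(K * ((if i = p then 1 else 0) * (if j = q then 1 else 0)
            - (if j = p then 1 else 0) * (if i = q then 1 else 0))) := by
  have h' (i j p q : Fin N) (hij : i < j) : cotCurvature α c X i j p q =
      -(K * ((if i = p then 1 else 0) * (if j = q then 1 else 0)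
            - (if j = p then 1 else 0) * (if i = q then 1 else 0))) := by
    rcases lt_trichotomy p q with hpq | rfl | hpq
    · exact h i j p q hij hpq
    · rw [self_eq_neg.1 (cotCurvature_swap_right X i j p p)]; ring
    · rw [cotCurvature_swap_right, h i j q p hij hpq]; ring
  rcases lt_trichotomy i j with hij | rfl | hij
  · exact h' i j p q hij
  · rw [self_eq_neg.1 (cotCurvature_swap_left X i i p q)]; ring
  · rw [cotCurvature_swap_left, h' j i p q hij]; ring

end

/-- Cancelling A leaves lam² = κA²/B, which is the square of w·B^(-1/2). -/
theorem sq_eq_iff_of_mul_eq {A B w lam κ : ℂ} (hA : A ≠ 0) (hB : B ≠ 0)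
    (hw : w ^ 2 = κ * A ^ 2) :
    lam ^ 2 * (A * B) = κ * A ^ 3 ↔
      lam = w * B ^ (-(1 / 2) : ℂ) ∨ lam = -(w * B ^ (-(1 / 2) : ℂ)) := by
  have hpow : (B ^ (-(1 / 2) : ℂ)) ^ 2 * B = 1 := by
    rw [← Complex.cpow_nat_mul]
    norm_num [Complex.cpow_neg_one, hB]
  rw [← sq_eq_sq_iff_eq_or_eq_neg, mul_pow, hw]
  constructor
  · intro h
    have h1 : lam ^ 2 * B = κ * A ^ 2 := mul_left_cancel₀ hA (by linear_combination h)
    linear_combination (B ^ (-(1 / 2) : ℂ)) ^ 2 * h1 - lam ^ 2 * hpow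
  · intro h
    rw [h]
    linear_combination κ * A ^ 3 * hpow

theorem ofReal_sqrt_three_sq : ((√3 : ℝ) : ℂ) ^ 2 = 3 := by
  rw [← Complex.ofReal_pow, Real.sq_sqrt (by norm_num)]; norm_num

/-! ### The configuration G₂. -/

section G2

theorem G2_gram (p q : ℂ) (i j : Fin 2) :
    ∑ k, G2mult q p k * (G2root k i * G2root k j) = if i = j then 3 / 2 * (p + 3 * q) else 0 := by
  have h3 := ofReal_sqrt_three_sq
  generalize hw : ((√3 : ℝ) : ℂ) = w at h3
  fin_cases i <;> fin_cases j <;> simp [G2mult, G2root, Fin.sum_univ_succ, hw]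
  · linear_combination (p / 2 + 3 / 2 * q) * h3
  · ring
  · ring
  · ring

theorem G2root_add :
    G2root 3 + G2root 5 = G2root 4 ∧ G2root 1 + G2root 2 = G2root 0 ∧
    G2root 4 + G2root 5 = G2root 0 ∧ G2root 4 + G2root 3 = G2root 1 ∧
    G2root 2 + G2root 3 = G2root 5 := by
  refine ⟨?_, ?_, ?_, ?_, ?_⟩ <;> ext i <;> fin_cases i <;> simp [G2root] <;> norm_num

theorem G2_cotCurvature {f : ℂ → ℂ} {D : Set ℂ} (hf : IsCotPotential f D) {X : Fin 3 → ℂ}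
    (hX : X ∈ potentialDomain G2root D) (p q : ℂ) :
    cotCurvature G2root (G2mult q p) X 0 1 0 1 = -(3 / 8 * ((p + 3 * q) * (p + 9 * q))) := by
  have h3 := ofReal_sqrt_three_sq
  obtain ⟨a1, a2, a4, a5, a6⟩ := G2root_add
  have h1 := cot_covalue_relation hf hX a1
  have h2 := cot_covalue_relation hf hX a2
  have h4 := cot_covalue_relation hf hX a4
  have h5 := cot_covalue_relation hf hX a5
  have h6 := cot_covalue_relation hf hX a6
  simp only [cotCurvature, cotTensor, Fin.sum_univ_two, Fin.sum_univ_six]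
  generalize Complex.cot (covalue (G2root 0) X) = c0 at *
  generalize Complex.cot (covalue (G2root 1) X) = c1 at *
  generalize Complex.cot (covalue (G2root 2) X) = c2 at *
  generalize Complex.cot (covalue (G2root 3) X) = c3 at *
  generalize Complex.cot (covalue (G2root 4) X) = c4 at *
  generalize Complex.cot (covalue (G2root 5) X) = c5 at *
  simp only [G2root, G2mult, Matrix.cons_val]
  generalize ((√3 : ℝ) : ℂ) = w at h3
  have h34 : w ^ 4 = 9 := by linear_combination (w ^ 2 + 3) * h3
  ring_nf
  simp only [h3, h34]
  -- `h1` is the triple of short roots, `h2` the triple of long ones, and `h4`, `h5`, `h6` mix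
  -- lengths. The short-short products in `h4 + h5 + h6` add up to minus the left side of `h1`, so
  -- the extra pq multiple of `h1` cancels them.
  linear_combination (-3 / 8 * p ^ 2 - 9 / 8 * p * q) * h1 - 81 / 8 * q ^ 2 * h2
    - 9 / 8 * p * q * (h4 + h5 + h6)

theorem solvesWDVV_G2_iff {p q : ℂ} (h3 : p + 3 * q ≠ 0) (h9 : p + 9 * q ≠ 0) {f : ℂ → ℂ}
    {D : Set ℂ} (hf : IsCotPotential f D) (hne : (potentialDomain G2root D).Nonempty) (lam : ℂ) :
    SolvesWDVV (prepotential G2root (G2mult q p) f lam) (potentialDomain G2root D) ↔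
      lam = 6 * (p + 3 * q) * (p + 9 * q) ^ (-(1 / 2) : ℂ) ∨
      lam = -(6 * (p + 3 * q) * (p + 9 * q) ^ (-(1 / 2) : ℂ)) := by
  rw [solvesWDVV_iff_of_cotCurvature lam le_rfl (mul_ne_zero (by norm_num) h3) (G2_gram p q) hf hne
    (K := 3 / 8 * ((p + 3 * q) * (p + 9 * q))),
    ← sq_eq_iff_of_mul_eq (κ := 36) h3 h9 (by ring)]
  · constructor <;> intro h
    · linear_combination 8 / 3 * h
    · linear_combination 3 / 8 * h
  · intro X hX
    refine cotCurvature_eq_of_lt fun i j a b hij hab => ?_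
    obtain ⟨rfl, rfl⟩ : i = 0 ∧ j = 1 := by omega
    obtain ⟨rfl, rfl⟩ : a = 0 ∧ b = 1 := by omega
    rw [G2_cotCurvature hf hX]
    simp

end G2

/-! ### The configuration F₄. -/

section F4

/-- An enumeration of the labels of the positive roots of `F₄`, short roots first. -/
def F4label : Fin 24 → F4Index :=
  ![.inl 0, .inl 1, .inl 2, .inl 3, .inr (.inl (true, true, true)),
      .inr (.inl (true, true, false)), .inr (.inl (true, false, true)),
      .inr (.inl (true, false, false)), .inr (.inl (false, true, true)),
      .inr (.inl (false, true, false)), .inr (.inl (false, false, true)),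
      .inr (.inl (false, false, false)), .inr (.inr (⟨(0, 1), by decide⟩, true)),
      .inr (.inr (⟨(0, 1), by decide⟩, false)), .inr (.inr (⟨(0, 2), by decide⟩, true)),
      .inr (.inr (⟨(0, 2), by decide⟩, false)), .inr (.inr (⟨(0, 3), by decide⟩, true)),
      .inr (.inr (⟨(0, 3), by decide⟩, false)), .inr (.inr (⟨(1, 2), by decide⟩, true)),
      .inr (.inr (⟨(1, 2), by decide⟩, false)), .inr (.inr (⟨(1, 3), by decide⟩, true)),
      .inr (.inr (⟨(1, 3), by decide⟩, false)), .inr (.inr (⟨(2, 3), by decide⟩, true)),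
      .inr (.inr (⟨(2, 3), by decide⟩, false))]

/-- The positive roots of `F₄` in coordinates, in the order of `F4label`. -/
noncomputable def F4vec : Fin 24 → Fin 4 → ℂ :=
  ![![1, 0, 0, 0], ![0, 1, 0, 0], ![0, 0, 1, 0], ![0, 0, 0, 1], ![1 / 2, 1 / 2, 1 / 2, 1 / 2],
      ![1 / 2, 1 / 2, 1 / 2, -1 / 2], ![1 / 2, 1 / 2, -1 / 2, 1 / 2],
      ![1 / 2, 1 / 2, -1 / 2, -1 / 2], ![1 / 2, -1 / 2, 1 / 2, 1 / 2],
      ![1 / 2, -1 / 2, 1 / 2, -1 / 2], ![1 / 2, -1 / 2, -1 / 2, 1 / 2],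
      ![1 / 2, -1 / 2, -1 / 2, -1 / 2], ![1, 1, 0, 0], ![1, -1, 0, 0], ![1, 0, 1, 0],
      ![1, 0, -1, 0], ![1, 0, 0, 1], ![1, 0, 0, -1], ![0, 1, 1, 0], ![0, 1, -1, 0],
      ![0, 1, 0, 1], ![0, 1, 0, -1], ![0, 0, 1, 1], ![0, 0, 1, -1]]

theorem F4root_F4label (n : Fin 24) : F4root (F4label n) = F4vec n := by
  ext i
  fin_cases n <;> fin_cases i <;> simp [F4root, F4label, F4vec, sgn, neg_div]

/-- The multiplicities of `F4vec`. -/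
def F4weight (r s : ℂ) : Fin 24 → ℂ :=
  ![s, s, s, s, s, s, s, s, s, s, s, s, r, r, r, r, r, r, r, r, r, r, r, r]

theorem F4mult_F4label (r s : ℂ) (n : Fin 24) : F4mult r s (F4label n) = F4weight r s n := by
  fin_cases n <;> rfl

theorem F4label_bijective : Function.Bijective F4label :=
  (Fintype.bijective_iff_injective_and_card _).2 ⟨by decide, by decide⟩

theorem sum_F4Index (φ : F4Index → ℂ) : ∑ k, φ k = ∑ n, φ (F4label n) :=
  (F4label_bijective.sum_comp φ).symm

theorem F4_gram (r s : ℂ) (i j : Fin 4) :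
    ∑ k, F4mult r s k * (F4root k i * F4root k j) = if i = j then 3 * (2 * r + s) else 0 := by
  simp only [sum_F4Index, F4root_F4label, F4mult_F4label, Fin.sum_univ_ofNat]
  fin_cases i <;> fin_cases j <;> simp [F4vec, F4weight] <;> ring

/-- The symmetric cubic tensor `∑ c_α C_α α ⊗ α ⊗ α` of the `F₄` configuration. -/
noncomputable def F4tensor (r s : ℂ) (C : Fin 24 → ℂ) (i p q : Fin 4) : ℂ :=
  ∑ n, F4weight r s n * (F4vec n i * F4vec n p * F4vec n q * C n)

theorem F4tensor_swap (r s : ℂ) (C : Fin 24 → ℂ) (i p q : Fin 4) :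
    F4tensor r s C i p q = F4tensor r s C p i q :=
  Finset.sum_congr rfl fun k _ => by ring

theorem F4tensor_swap_right (r s : ℂ) (C : Fin 24 → ℂ) (i p q : Fin 4) :
    F4tensor r s C i p q = F4tensor r s C i q p :=
  Finset.sum_congr rfl fun k _ => by ring

theorem cotTensor_F4root (r s : ℂ) (X : Fin 5 → ℂ) (i p q : Fin 4) :
    cotTensor F4root (F4mult r s) X i p q =
      F4tensor r s (fun n => Complex.cot (covalue (F4vec n) X)) i p q := by
  simp only [cotTensor, sum_F4Index, F4root_F4label, F4mult_F4label, F4tensor]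

/-- By total symmetry the 20 components with nondecreasing indices determine the tensor. -/
theorem F4tensor_values (r s : ℂ) (C : Fin 24 → ℂ) :
    F4tensor r s C 0 0 0 = s * C 0 + s / 8 * (C 4 + C 5 + C 6 + C 7 + C 8 + C 9 + C 10 + C 11)
      + r * (C 12 + C 13 + C 14 + C 15 + C 16 + C 17) ∧
    F4tensor r s C 0 0 1 = s / 8 * (C 4 + C 5 + C 6 + C 7 - C 8 - C 9 - C 10 - C 11) + r * (C 12
      - C 13) ∧
    F4tensor r s C 0 0 2 = s / 8 * (C 4 + C 5 - C 6 - C 7 + C 8 + C 9 - C 10 - C 11) + r * (C 14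
      - C 15) ∧
    F4tensor r s C 0 0 3 = s / 8 * (C 4 - C 5 + C 6 - C 7 + C 8 - C 9 + C 10 - C 11) + r * (C 16
      - C 17) ∧
    F4tensor r s C 0 1 1 = s / 8 * (C 4 + C 5 + C 6 + C 7 + C 8 + C 9 + C 10 + C 11) + r * (C 12
      + C 13) ∧
    F4tensor r s C 0 1 2 = s / 8 * (C 4 + C 5 - C 6 - C 7 - C 8 - C 9 + C 10 + C 11) ∧
    F4tensor r s C 0 1 3 = s / 8 * (C 4 - C 5 + C 6 - C 7 - C 8 + C 9 - C 10 + C 11) ∧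
    F4tensor r s C 0 2 2 = s / 8 * (C 4 + C 5 + C 6 + C 7 + C 8 + C 9 + C 10 + C 11) + r * (C 14
      + C 15) ∧
    F4tensor r s C 0 2 3 = s / 8 * (C 4 - C 5 - C 6 + C 7 + C 8 - C 9 - C 10 + C 11) ∧
    F4tensor r s C 0 3 3 = s / 8 * (C 4 + C 5 + C 6 + C 7 + C 8 + C 9 + C 10 + C 11) + r * (C 16
      + C 17) ∧
    F4tensor r s C 1 1 1 = s * C 1 + s / 8 * (C 4 + C 5 + C 6 + C 7 - C 8 - C 9 - C 10 - C 11)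
      + r * (C 12 - C 13 + C 18 + C 19 + C 20 + C 21) ∧
    F4tensor r s C 1 1 2 = s / 8 * (C 4 + C 5 - C 6 - C 7 + C 8 + C 9 - C 10 - C 11) + r * (C 18
      - C 19) ∧
    F4tensor r s C 1 1 3 = s / 8 * (C 4 - C 5 + C 6 - C 7 + C 8 - C 9 + C 10 - C 11) + r * (C 20
      - C 21) ∧
    F4tensor r s C 1 2 2 = s / 8 * (C 4 + C 5 + C 6 + C 7 - C 8 - C 9 - C 10 - C 11) + r * (C 18
      + C 19) ∧
    F4tensor r s C 1 2 3 = s / 8 * (C 4 - C 5 - C 6 + C 7 - C 8 + C 9 + C 10 - C 11) ∧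
    F4tensor r s C 1 3 3 = s / 8 * (C 4 + C 5 + C 6 + C 7 - C 8 - C 9 - C 10 - C 11) + r * (C 20
      + C 21) ∧
    F4tensor r s C 2 2 2 = s * C 2 + s / 8 * (C 4 + C 5 - C 6 - C 7 + C 8 + C 9 - C 10 - C 11)
      + r * (C 14 - C 15 + C 18 - C 19 + C 22 + C 23) ∧
    F4tensor r s C 2 2 3 = s / 8 * (C 4 - C 5 + C 6 - C 7 + C 8 - C 9 + C 10 - C 11) + r * (C 22
      - C 23) ∧
    F4tensor r s C 2 3 3 = s / 8 * (C 4 + C 5 - C 6 - C 7 + C 8 + C 9 - C 10 - C 11) + r * (C 22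
      + C 23) ∧
    F4tensor r s C 3 3 3 = s * C 3 + s / 8 * (C 4 - C 5 + C 6 - C 7 + C 8 - C 9 + C 10 - C 11)
      + r * (C 16 - C 17 + C 20 - C 21 + C 22 - C 23) := by
  simp only [F4tensor, Fin.sum_univ_ofNat, F4weight, F4vec, Matrix.cons_val]
  refine ⟨?_, ?_, ?_, ?_, ?_, ?_, ?_, ?_, ?_, ?_, ?_, ?_, ?_, ?_, ?_, ?_, ?_, ?_, ?_, ?_⟩
    <;> ring

/-- The 68 relations are one for each of the 16 long and 16 short A₂ subsystems, and two for each of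
the 18 B₂ subsystems. -/
theorem F4vec_add :
    F4vec 0 + F4vec 1 = F4vec 12 ∧ F4vec 0 + F4vec 2 = F4vec 14 ∧ F4vec 0 + F4vec 3 = F4vec 16 ∧
    F4vec 1 + F4vec 2 = F4vec 18 ∧ F4vec 1 + F4vec 3 = F4vec 20 ∧ F4vec 1 + F4vec 8 = F4vec 4 ∧
    F4vec 1 + F4vec 9 = F4vec 5 ∧ F4vec 1 + F4vec 10 = F4vec 6 ∧ F4vec 1 + F4vec 11 = F4vec 7 ∧
    F4vec 1 + F4vec 13 = F4vec 0 ∧ F4vec 2 + F4vec 3 = F4vec 22 ∧ F4vec 2 + F4vec 6 = F4vec 4 ∧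
    F4vec 2 + F4vec 7 = F4vec 5 ∧ F4vec 2 + F4vec 10 = F4vec 8 ∧ F4vec 2 + F4vec 11 = F4vec 9 ∧
    F4vec 2 + F4vec 15 = F4vec 0 ∧ F4vec 2 + F4vec 19 = F4vec 1 ∧ F4vec 3 + F4vec 5 = F4vec 4 ∧
    F4vec 3 + F4vec 7 = F4vec 6 ∧ F4vec 3 + F4vec 9 = F4vec 8 ∧ F4vec 3 + F4vec 11 = F4vec 10 ∧
    F4vec 3 + F4vec 17 = F4vec 0 ∧ F4vec 3 + F4vec 21 = F4vec 1 ∧ F4vec 3 + F4vec 23 = F4vec 2 ∧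
    F4vec 4 + F4vec 7 = F4vec 12 ∧ F4vec 4 + F4vec 9 = F4vec 14 ∧ F4vec 4 + F4vec 10 = F4vec 16 ∧
    F4vec 4 + F4vec 11 = F4vec 0 ∧ F4vec 5 + F4vec 6 = F4vec 12 ∧ F4vec 5 + F4vec 8 = F4vec 14 ∧
    F4vec 5 + F4vec 10 = F4vec 0 ∧ F4vec 5 + F4vec 11 = F4vec 17 ∧ F4vec 6 + F4vec 8 = F4vec 16 ∧
    F4vec 6 + F4vec 9 = F4vec 0 ∧ F4vec 6 + F4vec 11 = F4vec 15 ∧ F4vec 6 + F4vec 23 = F4vec 5 ∧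
    F4vec 7 + F4vec 8 = F4vec 0 ∧ F4vec 7 + F4vec 9 = F4vec 17 ∧ F4vec 7 + F4vec 10 = F4vec 15 ∧
    F4vec 7 + F4vec 22 = F4vec 4 ∧ F4vec 8 + F4vec 11 = F4vec 13 ∧ F4vec 8 + F4vec 19 = F4vec 6 ∧
    F4vec 8 + F4vec 21 = F4vec 5 ∧ F4vec 9 + F4vec 10 = F4vec 13 ∧ F4vec 9 + F4vec 19 = F4vec 7 ∧
    F4vec 9 + F4vec 20 = F4vec 4 ∧ F4vec 10 + F4vec 18 = F4vec 4 ∧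
    F4vec 10 + F4vec 21 = F4vec 7 ∧ F4vec 10 + F4vec 23 = F4vec 9 ∧
    F4vec 11 + F4vec 18 = F4vec 5 ∧ F4vec 11 + F4vec 20 = F4vec 6 ∧
    F4vec 11 + F4vec 22 = F4vec 8 ∧ F4vec 13 + F4vec 18 = F4vec 14 ∧
    F4vec 13 + F4vec 19 = F4vec 15 ∧ F4vec 13 + F4vec 20 = F4vec 16 ∧
    F4vec 13 + F4vec 21 = F4vec 17 ∧ F4vec 14 + F4vec 19 = F4vec 12 ∧
    F4vec 15 + F4vec 18 = F4vec 12 ∧ F4vec 15 + F4vec 22 = F4vec 16 ∧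
    F4vec 15 + F4vec 23 = F4vec 17 ∧ F4vec 16 + F4vec 21 = F4vec 12 ∧
    F4vec 16 + F4vec 23 = F4vec 14 ∧ F4vec 17 + F4vec 20 = F4vec 12 ∧
    F4vec 17 + F4vec 22 = F4vec 14 ∧ F4vec 19 + F4vec 22 = F4vec 20 ∧
    F4vec 19 + F4vec 23 = F4vec 21 ∧ F4vec 20 + F4vec 23 = F4vec 18 ∧
    F4vec 21 + F4vec 22 = F4vec 18 := by
  simp only [F4vec, Matrix.cons_val]
  refine ⟨?_, ?_, ?_, ?_, ?_, ?_, ?_, ?_, ?_, ?_, ?_, ?_, ?_, ?_, ?_, ?_, ?_, ?_, ?_, ?_, ?_, ?_,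
    ?_, ?_, ?_, ?_, ?_, ?_, ?_, ?_, ?_, ?_, ?_, ?_, ?_, ?_, ?_, ?_, ?_, ?_, ?_, ?_, ?_, ?_, ?_,
    ?_, ?_, ?_, ?_, ?_, ?_, ?_, ?_, ?_, ?_, ?_, ?_, ?_, ?_, ?_, ?_, ?_, ?_, ?_, ?_, ?_, ?_, ?_⟩
    <;>
    (ext i; fin_cases i <;> norm_num)

/-- The quadratic expression in the `C`'s which the addition theorem of the cotangent evaluates. -/
def additionForm (C : Fin 24 → ℂ) (k l m : Fin 24) : ℂ := C k * C l - C m * (C k + C l)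

/-- The left side is minus the commutator paired with bivectors b and d, grouped by rank-two
subsystems: r² for long A₂, s² for short A₂, rs for B₂. In a B₂ the two addition forms are added so
that the product of the two orthogonal short roots cancels. The factors 1/4 and 1/8 come from the
half-integral coordinates and from the inner product ±1/2 in a short A₂. Every addition form equals
1, so only a sum of squares of bivector coordinates has to be evaluated. -/
theorem F4_bivector_identity (r s : ℂ) {C : Fin 24 → ℂ}
    (hC : ∀ k l m, F4vec k + F4vec l = F4vec m → additionForm C k l m = 1)
    (b01 b02 b03 b12 b13 b23 d01 d02 d03 d12 d13 d23 : ℂ) :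
    r * s * (
      b01 * d01 * (additionForm C 0 1 12 + additionForm C 1 13 0) +
      b02 * d02 * (additionForm C 0 2 14 + additionForm C 2 15 0) +
      b03 * d03 * (additionForm C 0 3 16 + additionForm C 3 17 0) +
      b12 * d12 * (additionForm C 1 2 18 + additionForm C 2 19 1) +
      b13 * d13 * (additionForm C 1 3 20 + additionForm C 3 21 1) +
      b23 * d23 * (additionForm C 2 3 22 + additionForm C 3 23 2)) +
    r ^ 2 * (
      (b01 + b02 - b12) * (d01 + d02 - d12) * additionForm C 13 18 14 +
      (b01 - b02 + b12) * (d01 - d02 + d12) * additionForm C 13 19 15 +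
      (b01 + b03 - b13) * (d01 + d03 - d13) * additionForm C 13 20 16 +
      (b01 - b03 + b13) * (d01 - d03 + d13) * additionForm C 13 21 17 +
      (b01 - b02 - b12) * (d01 - d02 - d12) * additionForm C 14 19 12 +
      (b01 + b02 + b12) * (d01 + d02 + d12) * additionForm C 15 18 12 +
      (b02 + b03 - b23) * (d02 + d03 - d23) * additionForm C 15 22 16 +
      (b02 - b03 + b23) * (d02 - d03 + d23) * additionForm C 15 23 17 +
      (b01 - b03 - b13) * (d01 - d03 - d13) * additionForm C 16 21 12 +
      (b02 - b03 - b23) * (d02 - d03 - d23) * additionForm C 16 23 14 +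
      (b01 + b03 + b13) * (d01 + d03 + d13) * additionForm C 17 20 12 +
      (b02 + b03 + b23) * (d02 + d03 + d23) * additionForm C 17 22 14 +
      (b12 + b13 - b23) * (d12 + d13 - d23) * additionForm C 19 22 20 +
      (b12 - b13 + b23) * (d12 - d13 + d23) * additionForm C 19 23 21 +
      (b12 - b13 - b23) * (d12 - d13 - d23) * additionForm C 20 23 18 +
      (b12 + b13 + b23) * (d12 + d13 + d23) * additionForm C 21 22 18) +
    r * s / 4 * (

      (b02 + b03 + b12 + b13) * (d02 + d03 + d12 + d13) * (additionForm C 4 7 12 + additionForm C 7 22 4) +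
      (b01 + b03 - b12 + b23) * (d01 + d03 - d12 + d23) * (additionForm C 4 9 14 + additionForm C 9 20 4) +
      (b01 + b02 - b13 - b23) * (d01 + d02 - d13 - d23) * (additionForm C 4 10 16 + additionForm C 10 18 4) +
      (b02 - b03 + b12 - b13) * (d02 - d03 + d12 - d13) * (additionForm C 5 6 12 + additionForm C 6 23 5) +
      (b01 - b03 - b12 - b23) * (d01 - d03 - d12 - d23) * (additionForm C 5 8 14 + additionForm C 8 21 5) +
      (b01 + b02 + b13 + b23) * (d01 + d02 + d13 + d23) * (additionForm C 5 11 17 + additionForm C 11 18 5) +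
      (b01 - b02 - b13 + b23) * (d01 - d02 - d13 + d23) * (additionForm C 6 8 16 + additionForm C 8 19 6) +
      (b01 + b03 + b12 - b23) * (d01 + d03 + d12 - d23) * (additionForm C 6 11 15 + additionForm C 11 20 6) +
      (b01 - b02 + b13 - b23) * (d01 - d02 + d13 - d23) * (additionForm C 7 9 17 + additionForm C 9 19 7) +
      (b01 - b03 + b12 + b23) * (d01 - d03 + d12 + d23) * (additionForm C 7 10 15 + additionForm C 10 21 7) +
      (b02 + b03 - b12 - b13) * (d02 + d03 - d12 - d13) * (additionForm C 8 11 13 + additionForm C 11 22 8) +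
      (b02 - b03 - b12 + b13) * (d02 - d03 - d12 + d13) * (additionForm C 9 10 13 + additionForm C 10 23 9)) +
    s ^ 2 / 8 * (
      (b01 - b12 - b13) * (d01 - d12 - d13) * additionForm C 1 8 4 +
      (b01 - b12 + b13) * (d01 - d12 + d13) * additionForm C 1 9 5 +
      (b01 + b12 - b13) * (d01 + d12 - d13) * additionForm C 1 10 6 +
      (b01 + b12 + b13) * (d01 + d12 + d13) * additionForm C 1 11 7 +
      (b02 + b12 - b23) * (d02 + d12 - d23) * additionForm C 2 6 4 +
      (b02 + b12 + b23) * (d02 + d12 + d23) * additionForm C 2 7 5 +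
      (b02 - b12 - b23) * (d02 - d12 - d23) * additionForm C 2 10 8 +
      (b02 - b12 + b23) * (d02 - d12 + d23) * additionForm C 2 11 9 +
      (b03 + b13 + b23) * (d03 + d13 + d23) * additionForm C 3 5 4 +
      (b03 + b13 - b23) * (d03 + d13 - d23) * additionForm C 3 7 6 +
      (b03 - b13 + b23) * (d03 - d13 + d23) * additionForm C 3 9 8 +
      (b03 - b13 - b23) * (d03 - d13 - d23) * additionForm C 3 11 10 +
      (b01 + b02 + b03) * (d01 + d02 + d03) * additionForm C 4 11 0 +
      (b01 + b02 - b03) * (d01 + d02 - d03) * additionForm C 5 10 0 +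
      (b01 - b02 + b03) * (d01 - d02 + d03) * additionForm C 6 9 0 +
      (b01 - b02 - b03) * (d01 - d02 - d03) * additionForm C 7 8 0) =
    (2 * r + s) * (4 * r + s) *
      (b01 * d01 + b02 * d02 + b03 * d03 + b12 * d12 + b13 * d13 + b23 * d23) := by
  obtain ⟨a0, a1, a2, a3, a4, a5, a6, a7, a8, a9, a10, a11, a12, a13, a14, a15, a16, a17, a18,
    a19, a20, a21, a22, a23, a24, a25, a26, a27, a28, a29, a30, a31, a32, a33, a34, a35, a36,
    a37, a38, a39, a40, a41, a42, a43, a44, a45, a46, a47, a48, a49, a50, a51, a52, a53, a54,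
    a55, a56, a57, a58, a59, a60, a61, a62, a63, a64, a65, a66, a67⟩ := F4vec_add
  simp only [hC _ _ _ a0, hC _ _ _ a1, hC _ _ _ a2, hC _ _ _ a3, hC _ _ _ a4, hC _ _ _ a5,
    hC _ _ _ a6, hC _ _ _ a7, hC _ _ _ a8, hC _ _ _ a9, hC _ _ _ a10, hC _ _ _ a11, hC _ _ _ a12,
    hC _ _ _ a13, hC _ _ _ a14, hC _ _ _ a15, hC _ _ _ a16, hC _ _ _ a17, hC _ _ _ a18,
    hC _ _ _ a19, hC _ _ _ a20, hC _ _ _ a21, hC _ _ _ a22, hC _ _ _ a23, hC _ _ _ a24,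
    hC _ _ _ a25, hC _ _ _ a26, hC _ _ _ a27, hC _ _ _ a28, hC _ _ _ a29, hC _ _ _ a30,
    hC _ _ _ a31, hC _ _ _ a32, hC _ _ _ a33, hC _ _ _ a34, hC _ _ _ a35, hC _ _ _ a36,
    hC _ _ _ a37, hC _ _ _ a38, hC _ _ _ a39, hC _ _ _ a40, hC _ _ _ a41, hC _ _ _ a42,
    hC _ _ _ a43, hC _ _ _ a44, hC _ _ _ a45, hC _ _ _ a46, hC _ _ _ a47, hC _ _ _ a48,
    hC _ _ _ a49, hC _ _ _ a50, hC _ _ _ a51, hC _ _ _ a52, hC _ _ _ a53, hC _ _ _ a54,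
    hC _ _ _ a55, hC _ _ _ a56, hC _ _ _ a57, hC _ _ _ a58, hC _ _ _ a59, hC _ _ _ a60,
    hC _ _ _ a61, hC _ _ _ a62, hC _ _ _ a63, hC _ _ _ a64, hC _ _ _ a65, hC _ _ _ a66,
    hC _ _ _ a67]
  ring

theorem fin_four_lt_cases {i j : Fin 4} (h : i < j) :
    i = 0 ∧ j = 1 ∨ i = 0 ∧ j = 2 ∨ i = 0 ∧ j = 3 ∨ i = 1 ∧ j = 2 ∨ i = 1 ∧ j = 3 ∨
      i = 2 ∧ j = 3 := by
  revert i j; decide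

-- The bivector identity is applied with b = e_i∧e_j and d = e_p∧e_q, encoded by indicator
-- coefficients; each of the 36 index cases is then a polynomial identity in the values `C`.
set_option maxHeartbeats 1600000 in
theorem F4tensor_commutator (r s : ℂ) {C : Fin 24 → ℂ}
    (hC : ∀ k l m, F4vec k + F4vec l = F4vec m → additionForm C k l m = 1)
    {i j p q : Fin 4} (hij : i < j) (hpq : p < q) :
    ∑ m, (F4tensor r s C i p m * F4tensor r s C j m q
        - F4tensor r s C j p m * F4tensor r s C i m q) =
      -((2 * r + s) * (4 * r + s) * ((if i = p then 1 else 0) * (if j = q then 1 else 0)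
            - (if j = p then 1 else 0) * (if i = q then 1 else 0))) := by
  have key := F4_bivector_identity r s hC (if i = 0 ∧ j = 1 then 1 else 0)
    (if i = 0 ∧ j = 2 then 1 else 0) (if i = 0 ∧ j = 3 then 1 else 0)
    (if i = 1 ∧ j = 2 then 1 else 0) (if i = 1 ∧ j = 3 then 1 else 0)
    (if i = 2 ∧ j = 3 then 1 else 0) (if p = 0 ∧ q = 1 then 1 else 0)
    (if p = 0 ∧ q = 2 then 1 else 0) (if p = 0 ∧ q = 3 then 1 else 0)
    (if p = 1 ∧ q = 2 then 1 else 0) (if p = 1 ∧ q = 3 then 1 else 0)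
    (if p = 2 ∧ q = 3 then 1 else 0)
  obtain ⟨t0, t1, t2, t3, t4, t5, t6, t7, t8, t9, t10, t11, t12, t13, t14, t15, t16, t17, t18,
    t19⟩ := F4tensor_values r s C
  have w1 := F4tensor_swap r s C
  have w2 := F4tensor_swap_right r s C
  generalize F4tensor r s C = T at *
  simp only [Fin.sum_univ_four]
  obtain ⟨rfl, rfl⟩ | ⟨rfl, rfl⟩ | ⟨rfl, rfl⟩ | ⟨rfl, rfl⟩ | ⟨rfl, rfl⟩ | ⟨rfl, rfl⟩ :=
    fin_four_lt_cases hij <;>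
  obtain ⟨rfl, rfl⟩ | ⟨rfl, rfl⟩ | ⟨rfl, rfl⟩ | ⟨rfl, rfl⟩ | ⟨rfl, rfl⟩ | ⟨rfl, rfl⟩ :=
    fin_four_lt_cases hpq <;>
  simp only [Fin.reduceEq, and_true, and_false, and_self, reduceIte, additionForm] at key <;>
  -- The instances of `w1` and `w2` swap only decreasing neighbours, so they sort the indices into
  -- the form listed in `t0`, …, `t19`.
  simp only [w1 1 0, w1 2 0, w1 3 0, w1 2 1, w1 3 1, w1 3 2, w2 _ 1 0, w2 _ 2 0, w2 _ 3 0, w2 _ 2 1,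
    w2 _ 3 1, w2 _ 3 2, t0, t1, t2, t3, t4, t5, t6, t7, t8, t9, t10, t11, t12, t13, t14, t15, t16,
    t17, t18, t19, Fin.reduceEq, reduceIte] <;>
  linear_combination -key

theorem solvesWDVV_F4_iff {r s : ℂ} (h2 : 2 * r + s ≠ 0) (h4 : 4 * r + s ≠ 0) {f : ℂ → ℂ}
    {D : Set ℂ} (hf : IsCotPotential f D) (hne : (potentialDomain F4root D).Nonempty) (lam : ℂ) :
    SolvesWDVV (prepotential F4root (F4mult r s) f lam) (potentialDomain F4root D) ↔
      lam = 6 * (√3 : ℝ) * (2 * r + s) * (4 * r + s) ^ (-(1 / 2) : ℂ) ∨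
      lam = -(6 * (√3 : ℝ) * (2 * r + s) * (4 * r + s) ^ (-(1 / 2) : ℂ)) := by
  rw [solvesWDVV_iff_of_cotCurvature lam (by norm_num) (mul_ne_zero (by norm_num) h2)
      (F4_gram r s) hf hne (K := (2 * r + s) * (4 * r + s)),
    -- 108 = 4·3³, from 4g³ with g = 3(2r+s); it is also (6√3)².
    ← sq_eq_iff_of_mul_eq (κ := 108) h2 h4 (by
      linear_combination 36 * (2 * r + s) ^ 2 * ofReal_sqrt_three_sq)]
  · constructor <;> intro h <;> linear_combination h
  · intro X hX
    refine cotCurvature_eq_of_lt fun i j p q hij hpq => ?_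
    simp only [cotCurvature, cotTensor_F4root]
    refine F4tensor_commutator r s (fun k l m h => ?_) hij hpq
    simp only [← F4root_F4label] at h ⊢
    exact cot_covalue_relation hf hX h

end F4

end TrigWDVV

theorem mainTheorem11 :
    (∀ (f : ℂ → ℂ) (D : Set ℂ),
      TrigWDVV.IsTrilogBranch f D → TrigWDVV.IsCotPotential f D) ∧
    (∀ r s : ℂ, 2 * r + s ≠ 0 → 4 * r + s ≠ 0 →
      ∀ (f : ℂ → ℂ) (D : Set ℂ), TrigWDVV.IsCotPotential f D →
        (TrigWDVV.potentialDomain TrigWDVV.F4root D).Nonempty →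
        ∀ lam : ℂ,
          TrigWDVV.SolvesWDVV
              (TrigWDVV.prepotential TrigWDVV.F4root (TrigWDVV.F4mult r s) f lam)
              (TrigWDVV.potentialDomain TrigWDVV.F4root D) ↔
            lam = 6 * (√3 : ℝ) * (2 * r + s) * (4 * r + s) ^ (-(1 / 2) : ℂ) ∨
            lam = -(6 * (√3 : ℝ) * (2 * r + s) * (4 * r + s) ^ (-(1 / 2) : ℂ))) ∧
    (∀ p q : ℂ, p + 3 * q ≠ 0 → p + 9 * q ≠ 0 →
      ∀ (f : ℂ → ℂ) (D : Set ℂ), TrigWDVV.IsCotPotential f D →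
        (TrigWDVV.potentialDomain TrigWDVV.G2root D).Nonempty →
        ∀ lam : ℂ,
          TrigWDVV.SolvesWDVV
              (TrigWDVV.prepotential TrigWDVV.G2root (TrigWDVV.G2mult q p) f lam)
              (TrigWDVV.potentialDomain TrigWDVV.G2root D) ↔
            lam = 6 * (p + 3 * q) * (p + 9 * q) ^ (-(1 / 2) : ℂ) ∨
            lam = -(6 * (p + 3 * q) * (p + 9 * q) ^ (-(1 / 2) : ℂ))) := by
  exact ⟨fun _ _ h => h.isCotPotential,
    fun _ _ h2 h4 _ _ hf hne lam => TrigWDVV.solvesWDVV_F4_iff h2 h4 hf hne lam,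
    fun _ _ h3 h9 _ _ hf hne lam => TrigWDVV.solvesWDVV_G2_iff h3 h9 hf hne lam⟩
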